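/- Let $L$ be an even lattice of signature $(p,q)$ with $p\le q$ and Witt index $p$, with dual lattice $L^\vee$, discriminant group $A_L=L^\vee/L$, discriminant form $q_L(x)=(x,x)/2+\mathbb Z$, and $\sigma=p-q$. Let $\mathbb C A_L$ have standard basis $(\mathbf e_\lambda)_{\lambda\in A_L}$, write $e(x)=\exp(2\pi i x)$, and let $\rho_L$ be the Weil representation of $\mathrm{Mp}_2(\mathbb Z)$ on $\mathbb C A_L$, determined by $$\rho_L(T)\mathbf e_\lambda=e(q_L(\lambda))\,\mathbf e_\lambda,\qquad \rho_L(S)\mathbf e_\lambda=\frac{e(-\sigma/8)}{\sqrt{|A_L|}}\sum_{\mu\in A_L}e(-(\lambda,\mu))\,\mathbf e_\mu ,$$ where $T=\left(\begin{pmatrix}1&1\\0&1\end{pmatrix},1\right)$ and $S=\left(\begin{pmatrix}0&-1\\1&0\end{pmatrix},\sqrt\tau\right)$. Let $M^!(L)$ be the space of weakly holomorphic modular forms (holomorphic on the upper half plane, meromorphic at the cusp) of weight $\sigma/2$ and type $\rho_L$. For an even overlattice $L\subset M\subset L^\vee$, the pushforward $\downarrow^L_M:\mathbb C A_L\to\mathbb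 C A_M$ is the linear map that sends $\mathbf e_\mu$ to $\mathbf e_{p(\mu)}$ if $\mu\in M^\vee/L=(M/L)^\perp$, where $p:M^\vee/L\to M^\vee/M=A_M$ is the projection, and to $0$ otherwise. Let $I\subset L$ be a maximal (primitive, of rank $p$) isotropic sublattice. Put $I^*=I_{\mathbb Q}\cap L^\vee$, $L^*=\langle L,I^*\rangle$, and $K=(I^\perp\cap L)/I$, a negative-definite even lattice. There is a canonical identification $A_{L^*}= A_K$, which sends the class of $x\in (L^*)^\vee\cap I^\perp$ to the class of $x$ modulo $I_{\mathbb Q}$. Let $\downarrow^L_K$ be $\downarrow^L_{L^*}$ followed by this identification, and let $\Theta_{K^+}(\tau)=\sum_{l\in K^\vee}e^{-\pi i\tau (l,l)}\,\mathbf e_{[l]}^\vee$ be the theta series of $K^+=K(-1)$. The $\Theta$-product of $f,g\in M^!(L)$ with respect to $I$ is $$f*_I g=\langle f{\downarrow^L_K},\Theta_{K^+}\rangle\cdot g .$$ **Proposition.** Let $L'\subset L$ be a sublattice of finite index with $L=\langle L',I\rangle$, and put $I'=I\cap L'$. Then $f\mapsto f{\downarrow^{L'}_L}$ is a $\mathbb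 C$-linear map from $M^!(L')$ to $M^!(L)$, and it is compatible with the $\Theta$-products: $$(f{\downarrow^{L'}_L})*_I(g{\downarrow^{L'}_L})=(f*_{I'}g){\downarrow^{L'}_L}\qquad\text{for all } f,g\in M^!(L').$$ -/

import Mathlib

open UpperHalfPlane
open scoped MatrixGroups Manifold

namespace ThetaProduct

noncomputable section

/-! ### The metaplectic group -/

/-- An element `(M, φ)` of `Mp₂(ℤ)`: a matrix `M = (a b; c d) ∈ SL₂(ℤ)` and a holomorphic function
`φ` on the upper half plane with `φ(τ)² = cτ + d`. -/
@[ext]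
structure Mp2Z where
  mat : SL(2, ℤ)
  fn : ℍ → ℂ
  holo : MDifferentiable 𝓘(ℂ) 𝓘(ℂ) fn
  sq : ∀ τ : ℍ, fn τ ^ 2 = (mat 1 0 : ℂ) * (τ : ℂ) + (mat 1 1 : ℂ)

theorem coe_smul_eq (M : SL(2, ℤ)) (τ : ℍ) :
    ((M • τ : ℍ) : ℂ) = ((M 0 0 : ℂ) * τ + (M 0 1 : ℂ)) / ((M 1 0 : ℂ) * τ + (M 1 1 : ℂ)) := by
  rw [UpperHalfPlane.coe_specialLinearGroup_apply]
  simp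

theorem denom_ne_zero' (M : SL(2, ℤ)) (τ : ℍ) : (M 1 0 : ℂ) * (τ : ℂ) + (M 1 1 : ℂ) ≠ 0 := by
  have h := UpperHalfPlane.denom_ne_zero (M : GL (Fin 2) ℝ) τ
  simpa [UpperHalfPlane.denom] using h

theorem cocycle (M N : SL(2, ℤ)) (τ : ℍ) :
    ((M 1 0 : ℂ) * ((N • τ : ℍ) : ℂ) + (M 1 1 : ℂ)) * ((N 1 0 : ℂ) * (τ : ℂ) + (N 1 1 : ℂ)) =
      ((M * N) 1 0 : ℂ) * (τ : ℂ) + ((M * N) 1 1 : ℂ) := by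
  rw [coe_smul_eq]
  have h := denom_ne_zero' N τ
  simp only [Matrix.SpecialLinearGroup.coe_mul, Matrix.mul_apply, Fin.sum_univ_two]
  push_cast
  generalize (τ : ℂ) = z at *
  generalize ((N 1 0 : ℤ) : ℂ) = c at *
  generalize ((N 1 1 : ℤ) : ℂ) = d at *
  rw [add_mul, mul_assoc, div_mul_cancel₀ _ h]
  ring

theorem mdifferentiable_SL_smul (M : SL(2, ℤ)) :
    MDifferentiable 𝓘(ℂ) 𝓘(ℂ) (fun τ : ℍ => M • τ) := by
  apply UpperHalfPlane.mdifferentiable_smul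
  simp

/-- The group law `(M, φ)(N, ψ) = (MN, φ(Nτ)ψ(τ))`. -/
instance : Monoid Mp2Z where
  mul a b :=
    { mat := a.mat * b.mat
      fn := fun τ => a.fn (b.mat • τ) * b.fn τ
      holo := (a.holo.comp (mdifferentiable_SL_smul b.mat)).mul b.holo
      sq := fun τ => by rw [mul_pow, a.sq, b.sq, cocycle] }
  one :=
    { mat := 1
      fn := fun _ => 1
      holo := mdifferentiable_const
      sq := fun τ => by simp }
  mul_assoc a b c := by
    refine Mp2Z.ext (mul_assoc a.mat b.mat c.mat) ?_
    funext τ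
    change a.fn (b.mat • c.mat • τ) * b.fn (c.mat • τ) * c.fn τ =
      a.fn ((b.mat * c.mat) • τ) * (b.fn (c.mat • τ) * c.fn τ)
    rw [mul_smul, mul_assoc]
  one_mul a := by
    refine Mp2Z.ext (one_mul a.mat) ?_
    funext τ
    exact one_mul _
  mul_one a := by
    refine Mp2Z.ext (mul_one a.mat) ?_
    funext τ
    change a.fn ((1 : SL(2, ℤ)) • τ) * 1 = a.fn τ
    rw [one_smul, mul_one]

/-- The element `T = ((1 1; 0 1), 1)`. -/
def Mp2Z.T : Mp2Z where
  mat := ModularGroup.T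
  fn := fun _ => 1
  holo := mdifferentiable_const
  sq := fun τ => by simp [ModularGroup.T]

/-- The element `S = ((0 -1; 1 0), √τ)`, with the principal branch of the square root. -/
def Mp2Z.S : Mp2Z where
  mat := ModularGroup.S
  fn := fun τ => (τ : ℂ) ^ (1 / 2 : ℂ)
  holo := by
    intro τ
    have h : DifferentiableAt ℂ (fun z : ℂ => z ^ (1 / 2 : ℂ)) (τ : ℂ) :=
      DifferentiableAt.cpow_const differentiableAt_id (Or.inr τ.im_pos.ne')
    exact h.mdifferentiableAt.comp τ τ.mdifferentiable_coe
  sq := fun τ => by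
    rw [← Complex.cpow_nat_mul]
    simp [ModularGroup.S]

/-! ### Lattices and discriminant groups -/

section Lattice

variable {V : Type*} [AddCommGroup V] [Module ℚ V]

/-- `L` is an even lattice in the rational quadratic space `(V, B)`: a finitely generated
subgroup spanning `V` on which `B` is integral and `B x x` is even. -/
structure IsEvenLattice (B : LinearMap.BilinForm ℚ V) (L : Submodule ℤ V) : Prop where
  isLattice : Submodule.IsLattice ℚ L
  integral : ∀ x ∈ L, ∀ y ∈ L, ∃ n : ℤ, B x y = n
  even : ∀ x ∈ L, ∃ n : ℤ, B x x = 2 * n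

/-- `I` is a primitive isotropic sublattice of `L` of rank `p`. -/
structure IsMaximalIsotropic (B : LinearMap.BilinForm ℚ V) (L I : Submodule ℤ V) (p : ℕ) :
    Prop where
  le : I ≤ L
  isotropic : ∀ x ∈ I, ∀ y ∈ I, B x y = 0
  primitive : ∀ (n : ℤ) (x : V), n ≠ 0 → x ∈ L → n • x ∈ I → x ∈ I
  rank : Module.finrank ℤ I = p

/-- The number `σ = p - q` for `(V, B)` of signature `(p, q)`. -/
def sigma (B : LinearMap.BilinForm ℚ V) : ℤ :=
  (sigPos B.toQuadraticMap : ℤ) - sigNeg B.toQuadraticMap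

variable (B : LinearMap.BilinForm ℚ V) (L M : Submodule ℤ V)

/-- The discriminant group `A_L = L^∨ / L`. -/
abbrev DiscGroup : Type _ := B.dualSubmodule L ⧸ L.submoduleOf (B.dualSubmodule L)

/-- The class in `A_L` of an element of `L^∨`. -/
abbrev discMk : B.dualSubmodule L →ₗ[ℤ] DiscGroup B L :=
  (L.submoduleOf (B.dualSubmodule L)).mkQ

/-- The space `ℂA_L` with standard basis `e_λ = Finsupp.single λ 1`. -/
abbrev CA : Type _ := DiscGroup B L →₀ ℂ

/-- The basis vector `e_λ`. -/
abbrev basisVec (l : DiscGroup B L) : CA B L := Finsupp.single l 1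

/-- `e(x) = exp(2πix)`. -/
def e (x : ℚ) : ℂ := Complex.exp (2 * Real.pi * Complex.I * (x : ℂ))

/-- `e(q(λ))` for `λ ∈ A_L`, where `q(λ) = (x, x)/2 + ℤ` for a representative `x ∈ L^∨`
(see `eQuad_mk`). -/
def eQuad (l : DiscGroup B L) : ℂ :=
  e (B (Quotient.out l : B.dualSubmodule L) (Quotient.out l : B.dualSubmodule L) / 2)

/-- `e(-(λ, μ))` for `λ, μ ∈ A_L`, where `(λ, μ) = (x, y) + ℤ` for representatives `x, y ∈ L^∨`
(see `ePairNeg_mk`). -/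
def ePairNeg (l m : DiscGroup B L) : ℂ :=
  e (-(B (Quotient.out l : B.dualSubmodule L) (Quotient.out m : B.dualSubmodule L)))

theorem e_add_int (x : ℚ) (n : ℤ) : e (x + n) = e x := by
  unfold e
  rw [Complex.exp_eq_exp_iff_exists_int]
  exact ⟨n, by push_cast; ring⟩

variable {B L}

theorem mem_dual_iff {x : V} : x ∈ B.dualSubmodule L ↔ ∀ y ∈ L, ∃ n : ℤ, B x y = n := by
  rw [LinearMap.BilinForm.mem_dualSubmodule]
  simp only [Submodule.mem_one]
  constructor
  · intro h y hy
    obtain ⟨n, hn⟩ := h y hy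
    exact ⟨n, by simpa using hn.symm⟩
  · intro h y hy
    obtain ⟨n, hn⟩ := h y hy
    exact ⟨n, by simpa using hn.symm⟩

theorem discMk_eq_iff {x y : B.dualSubmodule L} :
    discMk B L x = discMk B L y ↔ (x : V) - y ∈ L := by
  simp only [Submodule.mkQ_apply]
  rw [Submodule.Quotient.eq]
  rfl

theorem out_sub_mem (x : B.dualSubmodule L) :
    ((Quotient.out (discMk B L x) : B.dualSubmodule L) : V) - x ∈ L := by
  rw [← discMk_eq_iff]
  exact Quotient.out_eq (discMk B L x)

theorem eQuad_mk (hB : B.IsSymm) (hL : IsEvenLattice B L) (x : B.dualSubmodule L) :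
    eQuad B L (discMk B L x) = e (B x x / 2) := by
  unfold eQuad
  set y := (Quotient.out (discMk B L x) : B.dualSubmodule L)
  have hd : (y : V) - x ∈ L := out_sub_mem x
  obtain ⟨m, hm⟩ := hL.even _ hd
  obtain ⟨n, hn⟩ := mem_dual_iff.1 x.2 _ hd
  have h : B y y / 2 = B x x / 2 + ((m + n : ℤ) : ℚ) := by
    have h1 : B (x : V) ((y : V) - x) = B ((y : V) - x) x := hB.eq _ _
    have h2 : B (y : V) y = B (x : V) x + B (x : V) ((y : V) - x) + B ((y : V) - x) x +
        B ((y : V) - x) ((y : V) - x) := by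
      simp only [map_sub, LinearMap.sub_apply]
      ring
    rw [h2, ← h1, hm, hn]
    push_cast
    ring
  rw [h, e_add_int]

theorem ePairNeg_mk (hB : B.IsSymm) (x y : B.dualSubmodule L) :
    ePairNeg B L (discMk B L x) (discMk B L y) = e (-(B x y)) := by
  unfold ePairNeg
  set x' := (Quotient.out (discMk B L x) : B.dualSubmodule L)
  set y' := (Quotient.out (discMk B L y) : B.dualSubmodule L)
  have hx : (x' : V) - x ∈ L := out_sub_mem x
  have hy : (y' : V) - y ∈ L := out_sub_mem y
  obtain ⟨m, hm⟩ := mem_dual_iff.1 x'.2 _ hy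
  obtain ⟨n, hn⟩ := mem_dual_iff.1 y.2 _ hx
  have h : -(B x' y') = -(B x y) + ((-(m + n) : ℤ) : ℚ) := by
    have h1 : B (y : V) ((x' : V) - x) = B ((x' : V) - x) y := hB.eq _ _
    have h2 : B (x' : V) y' = B (x : V) y + B ((x' : V) - x) y + B (x' : V) ((y' : V) - y) := by
      simp only [map_sub, LinearMap.sub_apply]
      ring
    rw [h2, ← h1, hm, hn]
    push_cast
    ring
  rw [h, e_add_int]

variable (B L)

/-! ### The Weil representation -/

/-- `ρ_L(T) e_λ = e(q(λ)) e_λ`. -/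
def weilT : Module.End ℂ (CA B L) :=
  Finsupp.linearCombination ℂ fun l => eQuad B L l • basisVec B L l

/-- `ρ_L(S) e_λ = e(-σ(L)/8) / √|A_L| * ∑_μ e(-(λ, μ)) e_μ`. -/
def weilS : Module.End ℂ (CA B L) :=
  Finsupp.linearCombination ℂ fun l =>
    (e (-(sigma B : ℚ) / 8) / (Real.sqrt (Nat.card (DiscGroup B L)) : ℂ)) •
      ∑ᶠ m : DiscGroup B L, ePairNeg B L l m • basisVec B L m

/-- The graph of the Weil representation `ρ_L : Mp₂(ℤ) → GL(ℂA_L)`, i.e. the set of all pairs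
`(g, ρ_L(g))`. As `Mp₂(ℤ)` is generated by `T` and `S` (as a monoid, `S` being of finite order
and `(ST)³ = S²`), and `ρ_L` is defined by its values on `T` and `S`, it is the submonoid
generated by `(T, ρ_L(T))` and `(S, ρ_L(S))`. -/
def weilGraph : Submonoid (Mp2Z × Module.End ℂ (CA B L)) :=
  Submonoid.closure {(Mp2Z.T, weilT B L), (Mp2Z.S, weilS B L)}

/-- `f` is a weakly holomorphic modular form of weight `σ(L)/2` and type `ρ_L`: it is holomorphic,
`f(Mτ) = φ(τ)^{σ(L)} ρ_L(M, φ) f(τ)` for all `(M, φ) ∈ Mp₂(ℤ)`, and it is meromorphic at the cusp,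
that is, each component is `O(|q|^{-N})` for some `N` as `Im τ → ∞`. -/
structure IsWeaklyHolomorphic (f : ℍ → CA B L) : Prop where
  holo : ∀ l, MDifferentiable 𝓘(ℂ) 𝓘(ℂ) fun τ => f τ l
  modular : ∀ g R, (g, R) ∈ weilGraph B L → ∀ τ : ℍ,
    f (g.mat • τ) = (g.fn τ ^ sigma B) • R (f τ)
  cusp : ∀ l, ∃ N : ℕ, (fun τ => f τ l) =O[atImInfty]
    fun τ : ℍ => Real.exp (2 * Real.pi * N * τ.im)

/-- The space `M^!(L)` of weakly holomorphic modular forms of weight `σ(L)/2` and type `ρ_L`. -/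
def MShriek : Submodule ℂ (ℍ → CA B L) where
  carrier := {f | IsWeaklyHolomorphic B L f}
  zero_mem' :=
    { holo := fun l => mdifferentiable_const
      modular := fun g R _ τ => by simp
      cusp := fun l => ⟨0, Asymptotics.isBigO_zero _ _⟩ }
  add_mem' {f g} hf hg :=
    { holo := fun l => (hf.holo l).add (hg.holo l)
      modular := fun a R h τ => by
        simp only [Pi.add_apply, hf.modular a R h τ, hg.modular a R h τ, map_add, smul_add]
      cusp := fun l => by
        obtain ⟨N, hN⟩ := hf.cusp l
        obtain ⟨N', hN'⟩ := hg.cusp l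
        have key : ∀ a b : ℕ, a ≤ b → (fun τ : ℍ => Real.exp (2 * Real.pi * a * τ.im)) =O[atImInfty]
            fun τ : ℍ => Real.exp (2 * Real.pi * b * τ.im) := by
          intro a b hab
          refine Asymptotics.IsBigO.of_norm_le fun τ => ?_
          rw [Real.norm_eq_abs, abs_of_pos (Real.exp_pos _)]
          refine Real.exp_le_exp.2 ?_
          have : (a : ℝ) ≤ b := by exact_mod_cast hab
          have := τ.im_pos
          gcongr
        exact ⟨max N N', (hN.trans (key _ _ (le_max_left _ _))).add
          (hN'.trans (key _ _ (le_max_right _ _)))⟩ }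
  smul_mem' c f hf :=
    { holo := fun l => (hf.holo l).const_smul c
      modular := fun a R h τ => by
        simp only [Pi.smul_apply, hf.modular a R h τ, map_smul]
        rw [smul_comm]
      cusp := fun l => by
        obtain ⟨N, hN⟩ := hf.cusp l
        exact ⟨N, hN.const_smul_left c⟩ }

/-! ### Pushforward to an overlattice -/

open Classical in
/-- The pushforward `↓^L_M : ℂA_L → ℂA_M` to an even overlattice `L ⊆ M ⊆ L^∨`. The orthogonal
complement of `J = M/L` in `A_L` is `J^⊥ = M^∨/L`, and `p : J^⊥ → A_M = M^∨/M` is the projection;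
`e_μ` goes to `e_{p(μ)}` if `μ ∈ J^⊥` and to `0` otherwise (see `push_basisVec_mk` and
`push_basisVec_of_notMem`). -/
def push : CA B L →ₗ[ℂ] CA B M :=
  Finsupp.linearCombination ℂ fun l =>
    if h : ∃ x : B.dualSubmodule M, ∃ hx : (x : V) ∈ B.dualSubmodule L, discMk B L ⟨x, hx⟩ = l
    then basisVec B M (discMk B M h.choose) else 0

variable {B L M}

theorem push_basisVec_mk (hLM : L ≤ M) (x : V) (hx : x ∈ B.dualSubmodule L)
    (hx' : x ∈ B.dualSubmodule M) :
    push B L M (basisVec B L (discMk B L ⟨x, hx⟩)) = basisVec B M (discMk B M ⟨x, hx'⟩) := by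
  have h : ∃ y : B.dualSubmodule M, ∃ hy : (y : V) ∈ B.dualSubmodule L,
      discMk B L ⟨y, hy⟩ = discMk B L ⟨x, hx⟩ := ⟨⟨x, hx'⟩, hx, rfl⟩
  unfold push
  rw [Finsupp.linearCombination_single, one_smul, dif_pos h]
  obtain ⟨hy, hy'⟩ := h.choose_spec
  congr 1
  rw [discMk_eq_iff] at hy' ⊢
  exact hLM hy'

theorem push_basisVec_of_notMem (hM : L ≤ B.dualSubmodule M) (x : V)
    (hx : x ∈ B.dualSubmodule L) (hx' : x ∉ B.dualSubmodule M) :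
    push B L M (basisVec B L (discMk B L ⟨x, hx⟩)) = 0 := by
  unfold push
  rw [Finsupp.linearCombination_single, one_smul, dif_neg]
  rintro ⟨y, hy, h⟩
  rw [discMk_eq_iff] at h
  refine hx' ?_
  have := Submodule.sub_mem _ y.2 (hM h)
  simpa using this

/-! ### The lattices `L^*` and `K = (I^⊥ ∩ L)/I` -/

/-- The form on `U^⊥/U` induced by `B` (for `U` isotropic; in general on `U^⊥/(U ∩ U^⊥)`). -/
def quotForm (hB : B.IsSymm) (U : Submodule ℚ V) :
    LinearMap.BilinForm ℚ (B.orthogonal U ⧸ U.submoduleOf (B.orthogonal U)) :=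
  (U.submoduleOf (B.orthogonal U)).liftQ
    (LinearMap.flip ((U.submoduleOf (B.orthogonal U)).liftQ
      (LinearMap.flip (B.restrict (B.orthogonal U)))
      (by
        intro u hu
        rw [LinearMap.mem_ker]
        ext x
        change B (x : V) (u : V) = 0
        rw [← hB.eq]
        exact x.2 u hu)))
    (by
      intro u hu
      rw [LinearMap.mem_ker]
      ext x
      change B (u : V) (x : V) = 0
      exact x.2 u hu)

theorem quotForm_mk (hB : B.IsSymm) (U : Submodule ℚ V) (x y : B.orthogonal U) :
    quotForm hB U (Submodule.Quotient.mk x) (Submodule.Quotient.mk y) = B x y := rfl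

variable (B) in
/-- `I^* = I_ℚ ∩ L^∨`. -/
def Istar (L I : Submodule ℤ V) : Submodule ℤ V :=
  (Submodule.span ℚ (I : Set V)).restrictScalars ℤ ⊓ B.dualSubmodule L

variable (B) in
/-- `L^* = ⟨L, I^*⟩`. -/
def Lstar (L I : Submodule ℤ V) : Submodule ℤ V := L ⊔ Istar B L I

variable (B) in
/-- The quotient space `I_ℚ^⊥ / I_ℚ`. -/
abbrev QuotSpace (I : Submodule ℤ V) : Type _ :=
  B.orthogonal (Submodule.span ℚ (I : Set V)) ⧸
    (Submodule.span ℚ (I : Set V)).submoduleOf (B.orthogonal (Submodule.span ℚ (I : Set V)))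

variable (B) in
/-- The projection `I_ℚ^⊥ → I_ℚ^⊥ / I_ℚ`. -/
abbrev quotMk (I : Submodule ℤ V) :
    B.orthogonal (Submodule.span ℚ (I : Set V)) →ₗ[ℚ] QuotSpace B I :=
  ((Submodule.span ℚ (I : Set V)).submoduleOf
    (B.orthogonal (Submodule.span ℚ (I : Set V)))).mkQ

/-- The form on `I_ℚ^⊥ / I_ℚ`. -/
abbrev quotB (hB : B.IsSymm) (I : Submodule ℤ V) : LinearMap.BilinForm ℚ (QuotSpace B I) :=
  quotForm hB (Submodule.span ℚ (I : Set V))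

variable (B) in
/-- The negative-definite lattice `K = (I^⊥ ∩ L)/I`, realized as the image of `I^⊥ ∩ L` in
`I_ℚ^⊥ / I_ℚ`. -/
def latticeK (L I : Submodule ℤ V) : Submodule ℤ (QuotSpace B I) :=
  (L.submoduleOf ((B.orthogonal (Submodule.span ℚ (I : Set V))).restrictScalars ℤ)).map
    ((quotMk B I).restrictScalars ℤ)

theorem quotMk_mem_dual (hB : B.IsSymm) (L I : Submodule ℤ V)
    (x : B.orthogonal (Submodule.span ℚ (I : Set V))) (hx : (x : V) ∈ B.dualSubmodule (Lstar B L I)) :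
    quotMk B I x ∈ (quotB hB I).dualSubmodule (latticeK B L I) := by
  rw [mem_dual_iff]
  rintro _ ⟨y, hy, rfl⟩
  have hy' : (y : V) ∈ L := hy
  exact mem_dual_iff.1 hx _ (Submodule.mem_sup_left hy')

open Classical in
/-- The canonical identification `A_{L^*} ≃ A_K`: a class in `A_{L^*}` is represented by some
`x ∈ (L^*)^∨ ∩ I^⊥`, and goes to the class of `x mod I_ℚ` (see `discIso_mk` and
`exists_orthogonal_rep`). -/
def discIso (hB : B.IsSymm) (L I : Submodule ℤ V) (l : DiscGroup B (Lstar B L I)) :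
    DiscGroup (quotB hB I) (latticeK B L I) :=
  if h : ∃ x : B.orthogonal (Submodule.span ℚ (I : Set V)),
      ∃ hx : (x : V) ∈ B.dualSubmodule (Lstar B L I), discMk B (Lstar B L I) ⟨x, hx⟩ = l
  then discMk (quotB hB I) (latticeK B L I)
    ⟨quotMk B I h.choose, quotMk_mem_dual hB L I _ h.choose_spec.choose⟩
  else 0

theorem span_isotropic {I : Submodule ℤ V} (hI : ∀ x ∈ I, ∀ y ∈ I, B x y = 0) :
    Submodule.span ℚ (I : Set V) ≤ B.orthogonal (Submodule.span ℚ (I : Set V)) := by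
  intro x hx y hy
  change B y x = 0
  induction hy using Submodule.span_induction with
  | zero => simp
  | add a b _ _ ha hb => simp [ha, hb]
  | smul c a _ ha => simp [ha]
  | mem a ha =>
    induction hx using Submodule.span_induction with
    | zero => simp
    | add u v _ _ hu hv => simp [hu, hv]
    | smul c u _ hu => simp [hu]
    | mem u hu => exact hI a ha u hu

theorem discIso_mk (hB : B.IsSymm) {L I : Submodule ℤ V} (hI : ∀ x ∈ I, ∀ y ∈ I, B x y = 0)
    (x : B.orthogonal (Submodule.span ℚ (I : Set V)))
    (hx : (x : V) ∈ B.dualSubmodule (Lstar B L I)) :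
    discIso hB L I (discMk B (Lstar B L I) ⟨x, hx⟩) =
      discMk (quotB hB I) (latticeK B L I) ⟨quotMk B I x, quotMk_mem_dual hB L I x hx⟩ := by
  have h : ∃ y : B.orthogonal (Submodule.span ℚ (I : Set V)),
      ∃ hy : (y : V) ∈ B.dualSubmodule (Lstar B L I),
        discMk B (Lstar B L I) ⟨y, hy⟩ = discMk B (Lstar B L I) ⟨x, hx⟩ := ⟨x, hx, rfl⟩
  unfold discIso
  rw [dif_pos h, discMk_eq_iff]
  have h' := h.choose_spec.choose_spec
  rw [discMk_eq_iff] at h'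
  obtain ⟨l, hl, i, hi, hli⟩ := Submodule.mem_sup.1 h'
  set y := h.choose
  have hiU : i ∈ Submodule.span ℚ (I : Set V) := hi.1
  have hlO : l ∈ B.orthogonal (Submodule.span ℚ (I : Set V)) := by
    have : l = (y : V) - x - i := by rw [← hli]; simp
    rw [this]
    exact Submodule.sub_mem _ (Submodule.sub_mem _ y.2 x.2) (span_isotropic hI hiU)
  refine ⟨⟨l, hlO⟩, hl, ?_⟩
  change quotMk B I ⟨l, hlO⟩ = quotMk B I y - quotMk B I x
  rw [← map_sub]
  refine (Submodule.Quotient.eq _).2 ?_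
  change l - ((y : V) - x) ∈ Submodule.span ℚ (I : Set V)
  rw [← hli]
  simpa using hiU

theorem exists_sub_mem_orthogonal (hB : B.IsSymm) (hnd : B.Nondegenerate) {L I : Submodule ℤ V}
    (hL : IsEvenLattice B L) (hIL : I ≤ L) (x : V) (hx : x ∈ B.dualSubmodule (Lstar B L I)) :
    ∃ y ∈ L, x - y ∈ B.orthogonal (Submodule.span ℚ (I : Set V)) := by
  classical
  have := hL.isLattice
  let b := Module.Free.chooseBasis ℤ L
  let b' := b.extendOfIsLattice ℚ
  have hspan : L = Submodule.span ℤ (Set.range b') := by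
    have h1 : Set.range b' = L.subtype '' Set.range b := by
      rw [← Set.range_comp]
      congr 1
      funext i
      simp [b']
    rw [h1, Submodule.span_image, b.span_eq, Submodule.map_top, Submodule.range_subtype]
  let d := B.dualBasis hnd b'
  have hD : B.dualSubmodule L = Submodule.span ℤ (Set.range d) := by
    conv_lhs => rw [hspan]
    exact LinearMap.BilinForm.dualSubmodule_span_of_basis B hnd b'
  have hdD : ∀ i, d i ∈ B.dualSubmodule L := fun i => by
    rw [hD]; exact Submodule.subset_span ⟨i, rfl⟩
  have : Module.Finite ℤ (B.dualSubmodule L) := by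
    rw [Module.Finite.iff_fg, hD]
    exact Submodule.fg_span (Set.finite_range d)
  let N : Submodule ℤ (B.dualSubmodule L) :=
    ((Submodule.span ℚ (I : Set V)).restrictScalars ℤ).submoduleOf (B.dualSubmodule L)
  have : Module.IsTorsionFree ℤ (B.dualSubmodule L ⧸ N) := by
    rw [Module.isTorsionFree_iff_smul_eq_zero]
    intro n z h
    by_contra hc
    push Not at hc
    obtain ⟨hn, hz⟩ := hc
    obtain ⟨z, rfl⟩ := N.mkQ_surjective z
    rw [← map_smul, Submodule.mkQ_apply, Submodule.Quotient.mk_eq_zero] at h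
    apply hz
    rw [Submodule.mkQ_apply, Submodule.Quotient.mk_eq_zero]
    have h' : n • (z : V) ∈ Submodule.span ℚ (I : Set V) := h
    rw [← Int.cast_smul_eq_zsmul ℚ] at h'
    have hn' : (n : ℚ) ≠ 0 := by exact_mod_cast hn
    exact (Submodule.smul_mem_iff (Submodule.span ℚ (I : Set V)) hn').1 h'
  have : Module.Free ℤ (B.dualSubmodule L ⧸ N) := inferInstance
  obtain ⟨s, hs⟩ := N.mkQ.exists_rightInverse_of_surjective (Submodule.range_mkQ N)
  let r : B.dualSubmodule L →ₗ[ℤ] B.dualSubmodule L := LinearMap.id - s ∘ₗ N.mkQ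
  have hr : ∀ z, r z ∈ N := fun z => by
    rw [← Submodule.Quotient.mk_eq_zero, ← Submodule.mkQ_apply]
    have := LinearMap.congr_fun hs (N.mkQ z)
    simp only [r, LinearMap.sub_apply, map_sub, LinearMap.comp_apply, LinearMap.id_apply] at this ⊢
    rw [this, sub_self]
  have hr' : ∀ z ∈ N, r z = z := fun z hz => by
    have : N.mkQ z = 0 := by rwa [Submodule.mkQ_apply, Submodule.Quotient.mk_eq_zero]
    simp [r, -Submodule.mkQ_apply, this]
  let f : B.dualSubmodule L →ₗ[ℤ] ℚ :=
    ((B x).restrictScalars ℤ) ∘ₗ (B.dualSubmodule L).subtype ∘ₗ r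
  have hf : ∀ z, ∃ n : ℤ, f z = n := fun z =>
    mem_dual_iff.1 hx _ (Submodule.mem_sup_right ⟨hr z, (r z).2⟩)
  choose c hc using fun i => hf ⟨d i, hdD i⟩
  refine ⟨∑ i, c i • b' i, ?_, ?_⟩
  · have hb : ∀ i, b' i ∈ L := fun i => by simp [b']
    exact Submodule.sum_mem _ fun i _ => Submodule.smul_mem _ _ (hb i)
  set y := ∑ i, c i • b' i with hy
  have hyd : ∀ i, B y (d i) = f ⟨d i, hdD i⟩ := fun j => by
    rw [hy, hc j]
    simp only [map_sum, LinearMap.sum_apply, map_zsmul, LinearMap.smul_apply]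
    simp [d, LinearMap.BilinForm.apply_dualBasis_right hnd hB b']
  have hyf : ∀ z : B.dualSubmodule L, B y z = f z := by
    rintro ⟨z, hz⟩
    have hz' := hz
    rw [hD] at hz'
    induction hz' using Submodule.span_induction with
    | mem z hz' => obtain ⟨i, rfl⟩ := hz'; exact hyd i
    | zero => exact (map_zero _).trans (map_zero f).symm
    | add u v hu hv h1 h2 =>
      have hu' : u ∈ B.dualSubmodule L := by rw [hD]; exact hu
      have hv' : v ∈ B.dualSubmodule L := by rw [hD]; exact hv
      have : (⟨u + v, hz⟩ : B.dualSubmodule L) = ⟨u, hu'⟩ + ⟨v, hv'⟩ := rfl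
      rw [this, map_add, ← h1 hu', ← h2 hv']
      exact map_add _ _ _
    | smul n u hu h1 =>
      have hu' : u ∈ B.dualSubmodule L := by rw [hD]; exact hu
      have : (⟨n • u, hz⟩ : B.dualSubmodule L) = n • ⟨u, hu'⟩ := rfl
      rw [this, map_zsmul, ← h1 hu']
      exact map_zsmul _ _ _
  intro u hu
  change B u (x - y) = 0
  rw [← hB.eq]
  induction hu using Submodule.span_induction with
  | zero => simp
  | add a b _ _ ha hb => rw [map_add, ha, hb, add_zero]
  | smul c a _ ha => rw [map_smul, ha, smul_zero]
  | mem u hu =>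
    have huD : u ∈ B.dualSubmodule L := mem_dual_iff.2 fun y hy => hL.integral u (hIL hu) y hy
    have h1 := hyf ⟨u, huD⟩
    have h2 : f ⟨u, huD⟩ = B x u := by
      change B x (r ⟨u, huD⟩ : B.dualSubmodule L) = _
      rw [hr' _ (show u ∈ Submodule.span ℚ (I : Set V) from Submodule.subset_span hu)]
    have h3 : B y u = B x u := h1.trans h2
    simp [h3]

theorem exists_orthogonal_rep (hB : B.IsSymm) (hnd : B.Nondegenerate) {L I : Submodule ℤ V}
    (hL : IsEvenLattice B L) (hIL : I ≤ L) (l : DiscGroup B (Lstar B L I)) :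
    ∃ x : B.orthogonal (Submodule.span ℚ (I : Set V)),
      ∃ hx : (x : V) ∈ B.dualSubmodule (Lstar B L I), discMk B (Lstar B L I) ⟨x, hx⟩ = l := by
  obtain ⟨⟨x, hx⟩, rfl⟩ := Submodule.mkQ_surjective _ l
  obtain ⟨y, hy, hxy⟩ := exists_sub_mem_orthogonal hB hnd hL hIL x hx
  have hy' : y ∈ B.dualSubmodule (Lstar B L I) := by
    rw [mem_dual_iff]
    intro w hw
    obtain ⟨a, ha, i, hi, rfl⟩ := Submodule.mem_sup.1 hw
    obtain ⟨m, hm⟩ := hL.integral y hy a ha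
    obtain ⟨n, hn⟩ := mem_dual_iff.1 hi.2 y hy
    refine ⟨m + n, ?_⟩
    rw [map_add, hm, show B y i = n from (hB.eq y i).trans hn]
    push_cast
    rfl
  refine ⟨⟨x - y, hxy⟩, Submodule.sub_mem _ hx hy', ?_⟩
  rw [discMk_eq_iff]
  have : x - y - x = -y := by abel
  rw [this]
  exact Submodule.neg_mem _ (Submodule.mem_sup_left hy)

/-! ### Theta series and the `Θ`-product -/

end Lattice

section Theta

variable {W : Type*} [AddCommGroup W] [Module ℚ W]

/-- The theta series `Θ_{K⁺}` of the positive-definite lattice `K⁺ = K(-1)`, for `K` a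
negative-definite even lattice in `(W, C)`. Its component at `ν ∈ A_{K⁺} = A_K` is
`∑ q^{-(l, l)/2}` over the `l ∈ K^∨` with class `ν`. -/
def thetaSeries (C : LinearMap.BilinForm ℚ W) (K : Submodule ℤ W) (τ : ℍ) (n : DiscGroup C K) : ℂ :=
  ∑' l : {l : C.dualSubmodule K // discMk C K l = n},
    Complex.exp (2 * Real.pi * Complex.I * (τ : ℂ) *
      ((-(C (l : C.dualSubmodule K) (l : C.dualSubmodule K)) / 2 : ℚ) : ℂ))

end Theta

section Product

variable {V : Type*} [AddCommGroup V] [Module ℚ V] {B : LinearMap.BilinForm ℚ V}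

/-- `↓^L_K : ℂA_L → ℂA_{L^*} = ℂA_K`. -/
def pushK (hB : B.IsSymm) (L I : Submodule ℤ V) :
    CA B L →ₗ[ℂ] CA (quotB hB I) (latticeK B L I) :=
  Finsupp.lmapDomain ℂ ℂ (discIso hB L I) ∘ₗ push B L (Lstar B L I)

/-- `ξ(f) = ⟨f↓^L_K, Θ_{K⁺}⟩`, where `⟨v, w⟩ = ∑_ν v_ν w_ν` is the contraction of `ρ_K` with
`ρ_{K⁺} = ρ_K^∨`. -/
def xi (hB : B.IsSymm) (L I : Submodule ℤ V) (f : ℍ → CA B L) (τ : ℍ) : ℂ :=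
  Finsupp.linearCombination ℂ (thetaSeries (quotB hB I) (latticeK B L I) τ) (pushK hB L I (f τ))

/-- The `Θ`-product `f ∗_I g = ξ(f) g`. -/
def thetaProd (hB : B.IsSymm) (L I : Submodule ℤ V) (f g : ℍ → CA B L) (τ : ℍ) : CA B L :=
  xi hB L I f τ • g τ

end Product

end

end ThetaProduct

namespace ThetaProduct

noncomputable section

/-! ### Finite-index sublattices, dual lattices, finiteness of the discriminant group -/

section Lattices

variable {V : Type*} [AddCommGroup V] [Module ℚ V] {B : LinearMap.BilinForm ℚ V}
  {L L' I : Submodule ℤ V}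

/-! Two independent facts give the result.

First, the pushforward intertwines the Weil representations of `L'` and `L`, which need only be
checked on the generators T and S. For T, both discriminant forms are computed from the same vector
x. For S, put J = L/L' inside `A_{L'}`. The coefficient at y of the pushforward of `ρ(S) e_x` is a
sum of e(-(x, ·)) over the coset y + J. By orthogonality of characters it equals |J| e(-(x, y)) if x
lies in the dual of L, and 0 otherwise; this is the coefficient on the `L` side once the normalizing
constants are compared, and they match because |A_{L'}| = |J|² |A_L|. The key lemmas are
`sum_overSub`, `card_discGroup_eq_sq_mul`, `push_comp_weilS` and `exists_push_comp_eq`. Holomorphy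
and growth at the cusp are preserved because the pushforward is a constant linear map between
finite-dimensional spaces.

Second, the scalar factor ξ is unchanged by the pushforward (`xi_push`). The lattices I' and I span
the same rational space U. Vectors of U pair to zero with I, and L = L' + I, so I'^* = I^*, L'^* =
L^*, and L' and L have the same image K in U^⊥/U. Since (L^*)^∨ ⊆ L^∨, pushing forward from L' to
L^* directly or through L gives the same map.

The product formula then follows from linearity of the pushforward at each τ. -/

omit [Module ℚ V] in
theorem exists_nsmul_mem_of_finite_quotient (hfin : Finite (L ⧸ L'.submoduleOf L)) :
    ∃ n : ℕ, n ≠ 0 ∧ ∀ x ∈ L, n • x ∈ L' := by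
  refine ⟨Nat.card (L ⧸ L'.submoduleOf L), Nat.card_pos.ne', fun x hx => ?_⟩
  have h := card_nsmul_eq_zero' (x := (L'.submoduleOf L).mkQ ⟨x, hx⟩)
  rw [← map_nsmul, Submodule.mkQ_apply, Submodule.Quotient.mk_eq_zero] at h
  exact h

theorem mem_span_of_nsmul_mem {n : ℕ} (hn : n ≠ 0) {x : V} {s : Set V} (h : n • x ∈ s) :
    x ∈ Submodule.span ℚ s := by
  have h1 : n • x ∈ Submodule.span ℚ s := Submodule.subset_span h
  rw [← Nat.cast_smul_eq_nsmul ℚ] at h1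
  exact (Submodule.smul_mem_iff _ (by exact_mod_cast hn)).1 h1

/-- The index multiplies `L` into `L'`, so both have the same rational span; finite generation is
Noetherianity of `L`. -/
theorem IsEvenLattice.of_finite_quotient (hL : IsEvenLattice B L) (hle : L' ≤ L)
    (hfin : Finite (L ⧸ L'.submoduleOf L)) : IsEvenLattice B L' where
  isLattice := by
    obtain ⟨n, hn, h⟩ := exists_nsmul_mem_of_finite_quotient hfin
    have := hL.isLattice
    have : IsNoetherian ℤ L := inferInstance
    refine ⟨?_, ?_⟩
    · exact (isNoetherian_submodule.1 this) L' hle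
    · rw [eq_top_iff, ← Submodule.IsLattice.span_eq_top (A := ℚ) (M := L), Submodule.span_le]
      exact fun x hx => mem_span_of_nsmul_mem hn (h x hx)
  integral x hx y hy := hL.integral x (hle hx) y (hle hy)
  even x hx := hL.even x (hle hx)

theorem span_inf_of_finite_quotient (hfin : Finite (L ⧸ L'.submoduleOf L)) (hI : I ≤ L) :
    Submodule.span ℚ ((I ⊓ L' : Submodule ℤ V) : Set V) = Submodule.span ℚ (I : Set V) := by
  obtain ⟨n, hn, h⟩ := exists_nsmul_mem_of_finite_quotient hfin
  refine le_antisymm (Submodule.span_mono inf_le_left) (Submodule.span_le.2 fun x hx => ?_)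
  exact mem_span_of_nsmul_mem hn ⟨I.smul_of_tower_mem n hx, h x (hI hx)⟩

theorem IsEvenLattice.le_dual (hL : IsEvenLattice B L) : L ≤ B.dualSubmodule L :=
  fun x hx => mem_dual_iff.2 fun y hy => hL.integral x hx y hy

theorem dual_anti (h : L' ≤ L) : B.dualSubmodule L ≤ B.dualSubmodule L' :=
  fun _ hx => mem_dual_iff.2 fun y hy => mem_dual_iff.1 hx y (h hy)

/-- Puts a lattice in the form required for dual bases: the ℤ-span of a ℚ-basis of the ambient
space. -/
theorem exists_basis_span_eq [FiniteDimensional ℚ V] (hL : Submodule.IsLattice ℚ L) :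
    ∃ b : Module.Basis (Module.Free.ChooseBasisIndex ℤ L) ℚ V,
      L = Submodule.span ℤ (Set.range b) := by
  let b := Module.Free.chooseBasis ℤ L
  refine ⟨b.extendOfIsLattice ℚ, ?_⟩
  have h1 : Set.range (b.extendOfIsLattice ℚ) = L.subtype '' Set.range b := by
    rw [← Set.range_comp]
    congr 1
    funext i
    simp
  rw [h1, Submodule.span_image, b.span_eq, Submodule.map_top, Submodule.range_subtype]

theorem dual_dual [FiniteDimensional ℚ V] (hB : B.IsSymm) (hnd : B.Nondegenerate)
    (hL : Submodule.IsLattice ℚ L) : B.dualSubmodule (B.dualSubmodule L) = L := by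
  obtain ⟨b, hb⟩ := exists_basis_span_eq hL
  rw [hb]
  exact B.dualSubmodule_dualSubmodule_of_basis hnd hB b

theorem exists_nsmul_mem_of_span_eq_top (hL : Submodule.span ℚ (L : Set V) = ⊤) (x : V) :
    ∃ n : ℕ, n ≠ 0 ∧ n • x ∈ L := by
  have hx : x ∈ Submodule.span ℚ (L : Set V) := hL ▸ Submodule.mem_top
  induction hx using Submodule.span_induction with
  | mem x hx => exact ⟨1, one_ne_zero, by simpa using hx⟩
  | zero => exact ⟨1, one_ne_zero, by simp⟩
  | add x y _ _ hx hy =>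
    obtain ⟨m, hm, hx⟩ := hx
    obtain ⟨n, hn, hy⟩ := hy
    refine ⟨m * n, mul_ne_zero hm hn, ?_⟩
    rw [smul_add, mul_comm, mul_smul, mul_comm, mul_smul]
    exact add_mem (L.smul_of_tower_mem n hx) (L.smul_of_tower_mem m hy)
  | smul c x _ hx =>
    obtain ⟨m, hm, hx⟩ := hx
    -- The denominator of `c` clears the scalar, and `m` clears `x`.
    refine ⟨c.den * m, mul_ne_zero c.den_nz hm, ?_⟩
    have : (c.den * m) • c • x = c.num • m • x := by
      rw [← Nat.cast_smul_eq_nsmul ℚ, ← Nat.cast_smul_eq_nsmul ℚ, ← Int.cast_smul_eq_zsmul ℚ,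
        smul_smul, smul_smul]
      congr 1
      have := Rat.den_mul_eq_num c
      push_cast
      rw [← this]
      ring
    rw [this]
    exact L.smul_mem _ hx

/-- The dual lattice is generated by a dual basis, and each of its vectors has a nonzero multiple in
`L`; a finitely generated torsion group is finite. -/
theorem finite_discGroup [FiniteDimensional ℚ V] (hnd : B.Nondegenerate)
    (hL : Submodule.IsLattice ℚ L) : Finite (DiscGroup B L) := by
  classical
  obtain ⟨b, hb⟩ := exists_basis_span_eq hL
  have : Module.Finite ℤ (B.dualSubmodule L) := by
    rw [Module.Finite.iff_fg]
    conv => rw [hb]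
    rw [LinearMap.BilinForm.dualSubmodule_span_of_basis B hnd b]
    exact Submodule.fg_span (Set.finite_range _)
  apply Module.finite_of_fg_torsion
  intro l
  obtain ⟨x, rfl⟩ := Submodule.mkQ_surjective _ l
  obtain ⟨n, hn, h⟩ := exists_nsmul_mem_of_span_eq_top hL.span_eq_top (x : V)
  refine ⟨⟨n, mem_nonZeroDivisors_of_ne_zero (by exact_mod_cast hn)⟩, ?_⟩
  change (n : ℤ) • discMk B L x = 0
  rw [← map_zsmul, Submodule.mkQ_apply, Submodule.Quotient.mk_eq_zero]
  change ((n : ℤ) • (x : V)) ∈ L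
  rwa [natCast_zsmul]

/-! ### Characters of the discriminant group and their sums over L/L' -/

theorem e_add (x y : ℚ) : e (x + y) = e x * e y := by
  unfold e
  rw [← Complex.exp_add]
  congr 1
  push_cast
  ring

theorem e_zero : e 0 = 1 := by simp [e]

theorem e_eq_one_iff {x : ℚ} : e x = 1 ↔ ∃ n : ℤ, x = n := by
  unfold e
  rw [Complex.exp_eq_one_iff]
  refine exists_congr fun n => ⟨fun h => ?_, fun h => by rw [h]; push_cast; ring⟩
  have h2 : (2 * Real.pi * Complex.I : ℂ) ≠ 0 := Complex.two_pi_I_ne_zero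
  rw [mul_comm] at h
  exact_mod_cast mul_right_cancel₀ h2 h

/-- The character `μ ↦ e(-(λ, μ))` of the discriminant group. -/
def pairChar (hB : B.IsSymm) (L : Submodule ℤ V) (l : DiscGroup B L) :
    AddChar (DiscGroup B L) ℂ where
  toFun := ePairNeg B L l
  map_zero_eq_one' := by
    obtain ⟨x, rfl⟩ := Submodule.mkQ_surjective _ l
    rw [← map_zero (discMk B L), ePairNeg_mk hB]
    simp [e_zero]
  map_add_eq_mul' m n := by
    obtain ⟨x, rfl⟩ := Submodule.mkQ_surjective _ l
    obtain ⟨y, rfl⟩ := Submodule.mkQ_surjective _ m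
    obtain ⟨z, rfl⟩ := Submodule.mkQ_surjective _ n
    rw [← map_add, ePairNeg_mk hB, ePairNeg_mk hB, ePairNeg_mk hB, ← e_add]
    congr 1
    push_cast
    rw [map_add]
    ring

theorem pairChar_apply (hB : B.IsSymm) (l m : DiscGroup B L) :
    pairChar hB L l m = ePairNeg B L l m := rfl

theorem ePairNeg_comm (hB : B.IsSymm) (l m : DiscGroup B L) :
    ePairNeg B L l m = ePairNeg B L m l := by
  unfold ePairNeg
  congr 2
  exact hB.eq _ _

/-- The subgroup `J = M / L` of `A_L`. -/
def overSub (B : LinearMap.BilinForm ℚ V) (L M : Submodule ℤ V) : Submodule ℤ (DiscGroup B L) :=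
  (M.submoduleOf (B.dualSubmodule L)).map (discMk B L)

theorem discMk_mem_overSub (hLM : L' ≤ L) {x : B.dualSubmodule L'} :
    discMk B L' x ∈ overSub B L' L ↔ (x : V) ∈ L := by
  constructor
  · rintro ⟨y, hy, h⟩
    rw [discMk_eq_iff] at h
    have := L.sub_mem hy (hLM h)
    simpa using this
  · exact fun h => ⟨x, h, rfl⟩

/-- Since e(t) = 1 exactly for integral t, the character of x is trivial on L/L' when x pairs
integrally with `L`. The `0` of `AddChar` is the trivial character. -/
theorem pairChar_restrict_eq_zero_iff (hB : B.IsSymm) (hLM : L' ≤ L)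
    (hLD : L ≤ B.dualSubmodule L') (x : B.dualSubmodule L') :
    (pairChar hB L' (discMk B L' x)).compAddMonoidHom (overSub B L' L).subtype.toAddMonoidHom = 0 ↔
      (x : V) ∈ B.dualSubmodule L := by
  rw [mem_dual_iff, AddChar.ext_iff]
  constructor
  · intro h y hy
    have h1 := h ⟨discMk B L' ⟨y, hLD hy⟩, (discMk_mem_overSub hLM).2 hy⟩
    have h2 : ePairNeg B L' (discMk B L' x) (discMk B L' ⟨y, hLD hy⟩) = 1 := h1
    rw [ePairNeg_mk hB, e_eq_one_iff] at h2
    obtain ⟨n, hn⟩ := h2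
    exact ⟨-n, by push_cast; rw [← hn]; simp⟩
  · rintro h ⟨_, y, hy, rfl⟩
    change ePairNeg B L' (discMk B L' x) (discMk B L' y) = 1
    obtain ⟨n, hn⟩ := h y hy
    rw [ePairNeg_mk hB, e_eq_one_iff]
    exact ⟨-n, by push_cast; rw [← hn]⟩

open Classical in
-- Orthogonality of characters on J = L/L'. The sum is written over all of `A_{L'}` with an
-- indicator so that it can be exchanged with, or compared to, other sums over `A_{L'}`.
theorem sum_overSub (hB : B.IsSymm) (hLM : L' ≤ L) (hLD : L ≤ B.dualSubmodule L')
    [Fintype (DiscGroup B L')] (x : B.dualSubmodule L') :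
    ∑ j : DiscGroup B L', (if j ∈ overSub B L' L then ePairNeg B L' (discMk B L' x) j else 0) =
      if (x : V) ∈ B.dualSubmodule L then (Nat.card (overSub B L' L) : ℂ) else 0 := by
  have h := AddChar.sum_eq_ite
    ((pairChar hB L' (discMk B L' x)).compAddMonoidHom (overSub B L' L).subtype.toAddMonoidHom)
  rw [← Finset.sum_filter, Finset.sum_subtype (p := fun j => j ∈ overSub B L' L) _ (by simp)]
  refine Eq.trans ?_ (h.trans ?_)
  · rfl
  · simp only [pairChar_restrict_eq_zero_iff hB hLM hLD, Nat.card_eq_fintype_card]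

end Lattices

/-! ### Orders of discriminant groups; the pushforward intertwines the Weil representations -/

section Pushforward

variable {V : Type*} [AddCommGroup V] [Module ℚ V] {B : LinearMap.BilinForm ℚ V}
  {L L' I : Submodule ℤ V}

/-- The kernel of the projection to `A_{L'}` is `L'`, so the image of `L` has order [L : L']. -/
theorem card_overSub (hLD : L ≤ B.dualSubmodule L') :
    Nat.card (overSub B L' L) = L'.toAddSubgroup.relIndex L.toAddSubgroup := by
  have h := AddSubgroup.relIndex_ker
    (L.submoduleOf (B.dualSubmodule L')).toAddSubgroup (discMk B L').toAddMonoidHom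
  have hk : (discMk B L').toAddMonoidHom.ker =
      L'.toAddSubgroup.addSubgroupOf (B.dualSubmodule L').toAddSubgroup := by
    ext x
    change discMk B L' x = 0 ↔ _
    rw [Submodule.mkQ_apply, Submodule.Quotient.mk_eq_zero]
    rfl
  rw [hk] at h
  refine h.symm.trans ?_
  exact AddSubgroup.relIndex_addSubgroupOf (H := L'.toAddSubgroup) (K := L.toAddSubgroup) hLD

theorem card_discGroup :
    Nat.card (DiscGroup B L) =
      L.toAddSubgroup.relIndex (B.dualSubmodule L).toAddSubgroup := rfl

/-- This is |A| = |J| |J^⊥| for A = `A_{L'}`, by summing e(-(l, j)) over l ∈ A and j ∈ J in both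
orders. Summing over j first leaves |J| for each l ∈ J^⊥; summing over l first leaves |A| at j = 0
only, by nondegeneracy of the pairing. -/
theorem card_discGroup_eq_card_mul [FiniteDimensional ℚ V] (hB : B.IsSymm)
    (hnd : B.Nondegenerate) (hL' : IsEvenLattice B L') (hLM : L' ≤ L)
    (hLD : L ≤ B.dualSubmodule L') :
    Nat.card (DiscGroup B L') =
      Nat.card (overSub B L' L) * Nat.card (overSub B L' (B.dualSubmodule L)) := by
  classical
  have := finite_discGroup hnd hL'.isLattice
  have := Fintype.ofFinite (DiscGroup B L')
  have hL'D : L' ≤ B.dualSubmodule L := fun x hx => by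
    rw [mem_dual_iff]
    intro y hy
    obtain ⟨n, hn⟩ := mem_dual_iff.1 (hLD hy) x hx
    exact ⟨n, (hB.eq _ _).trans hn⟩
  have key : ∑ l : DiscGroup B L', ∑ j : DiscGroup B L',
      (if j ∈ overSub B L' L then ePairNeg B L' l j else 0) =
      ∑ j : DiscGroup B L', ∑ l : DiscGroup B L',
        (if j ∈ overSub B L' L then ePairNeg B L' l j else 0) := Finset.sum_comm
  have h1 : ∀ l : DiscGroup B L', ∑ j : DiscGroup B L',
      (if j ∈ overSub B L' L then ePairNeg B L' l j else 0) =
      if l ∈ overSub B L' (B.dualSubmodule L) then (Nat.card (overSub B L' L) : ℂ) else 0 := by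
    intro l
    obtain ⟨x, rfl⟩ := Submodule.mkQ_surjective _ l
    rw [sum_overSub hB hLM hLD]
    simp only [discMk_mem_overSub hL'D]
  have h2 : ∀ j : DiscGroup B L', ∑ l : DiscGroup B L',
      (if j ∈ overSub B L' L then ePairNeg B L' l j else 0) =
      if j = 0 then (Nat.card (DiscGroup B L') : ℂ) else 0 := by
    intro j
    by_cases hj : j ∈ overSub B L' L
    · simp only [if_pos hj]
      obtain ⟨y, rfl⟩ := Submodule.mkQ_surjective _ j
      have h := AddChar.sum_eq_ite (pairChar hB L' (discMk B L' y))
      simp only [pairChar_apply] at h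
      simp only [ePairNeg_comm hB _ (discMk B L' y)]
      rw [h, Nat.card_eq_fintype_card]
      refine if_congr ?_ rfl rfl
      rw [Submodule.mkQ_apply, Submodule.Quotient.mk_eq_zero]
      change _ ↔ (y : V) ∈ L'
      -- Nondegeneracy of the pairing on `A_{L'}` is biduality: a vector pairing integrally with all
      -- of L'^∨ lies in `L'`.
      have hdd : (y : V) ∈ L' ↔ (y : V) ∈ B.dualSubmodule (B.dualSubmodule L') := by
        rw [dual_dual hB hnd hL'.isLattice]
      rw [hdd, mem_dual_iff, AddChar.ext_iff]
      constructor
      · intro h x hx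
        have h2 : ePairNeg B L' (discMk B L' y) (discMk B L' ⟨x, hx⟩) = 1 := h _
        rw [ePairNeg_mk hB, e_eq_one_iff] at h2
        obtain ⟨n, hn⟩ := h2
        exact ⟨-n, by push_cast; rw [← hn]; simp⟩
      · intro h l
        obtain ⟨x, rfl⟩ := Submodule.mkQ_surjective _ l
        obtain ⟨n, hn⟩ := h x x.2
        change ePairNeg B L' (discMk B L' y) (discMk B L' x) = 1
        rw [ePairNeg_mk hB, e_eq_one_iff]
        exact ⟨-n, by push_cast; rw [← hn]⟩
    · have : j ≠ 0 := fun h => hj (h ▸ Submodule.zero_mem _)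
      simp [hj, this]
  simp only [h1, h2] at key
  rw [Finset.sum_ite_eq' Finset.univ (0 : DiscGroup B L'), if_pos (Finset.mem_univ _),
    ← Finset.sum_filter, Finset.sum_const, nsmul_eq_mul, ← Fintype.card_subtype] at key
  have h3 : Fintype.card {x // x ∈ overSub B L' (B.dualSubmodule L)} =
      Nat.card (overSub B L' (B.dualSubmodule L)) := Nat.card_eq_fintype_card.symm
  rw [h3] at key
  rw [mul_comm]
  exact_mod_cast key.symm

/-- The order of J^⊥ = L^∨/L' splits as [L^∨ : L][L : L'] = |A_L| |J|, which supplies the second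
factor |J|. -/
theorem card_discGroup_eq_sq_mul [FiniteDimensional ℚ V] (hB : B.IsSymm)
    (hnd : B.Nondegenerate) (hL : IsEvenLattice B L) (hL' : IsEvenLattice B L') (hLM : L' ≤ L) :
    Nat.card (DiscGroup B L') = Nat.card (overSub B L' L) ^ 2 * Nat.card (DiscGroup B L) := by
  have hLD : L ≤ B.dualSubmodule L' := hL.le_dual.trans (dual_anti hLM)
  rw [card_discGroup_eq_card_mul hB hnd hL' hLM hLD,
    card_overSub (dual_anti hLM), card_overSub hLD, card_discGroup,
    ← AddSubgroup.relIndex_mul_relIndex L'.toAddSubgroup L.toAddSubgroup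
      (B.dualSubmodule L).toAddSubgroup hLM hL.le_dual]
  ring

open Classical in
-- The basis vectors sent to `e_y` are exactly those indexed by the coset y + J, because y + x ≡ y
-- modulo `L` means x ∈ L.
theorem push_basisVec_apply (hLM : L' ≤ L) (hL : L ≤ B.dualSubmodule L)
    (y : B.dualSubmodule L) (j : DiscGroup B L') :
    push B L' L (basisVec B L' (discMk B L' ⟨y, dual_anti hLM y.2⟩ + j)) (discMk B L y) =
      if j ∈ overSub B L' L then 1 else 0 := by
  obtain ⟨x, rfl⟩ := Submodule.mkQ_surjective _ j
  simp only [discMk_mem_overSub hLM]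
  rw [← map_add]
  by_cases hx : (y + x : V) ∈ B.dualSubmodule L
  · have h := push_basisVec_mk (B := B) hLM (y + x : V)
      (Submodule.add_mem _ (dual_anti hLM y.2) x.2) hx
    refine (congrArg (fun v : CA B L => v (discMk B L y)) h).trans ?_
    rw [Finsupp.single_apply]
    refine if_congr ?_ rfl rfl
    rw [discMk_eq_iff]
    simp
  · have h := push_basisVec_of_notMem (B := B) (L := L') (M := L)
      (hLM.trans hL) (y + x : V) (Submodule.add_mem _ (dual_anti hLM y.2) x.2) hx
    refine (congrArg (fun v : CA B L => v (discMk B L y)) h).trans ?_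
    rw [if_neg, Finsupp.zero_apply]
    exact fun hx' => hx (Submodule.add_mem _ y.2 (hL hx'))

theorem push_comp_weilT (hB : B.IsSymm) (hL : IsEvenLattice B L) (hL' : IsEvenLattice B L')
    (hLM : L' ≤ L) : push B L' L ∘ₗ weilT B L' = weilT B L ∘ₗ push B L' L := by
  refine Finsupp.lhom_ext' fun l => LinearMap.ext_ring ?_
  obtain ⟨⟨x, hx⟩, rfl⟩ := Submodule.mkQ_surjective _ l
  change push B L' L (weilT B L' (basisVec B L' _)) = weilT B L (push B L' L (basisVec B L' _))
  rw [weilT, Finsupp.linearCombination_single, one_smul, map_smul]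
  by_cases hx' : x ∈ B.dualSubmodule L
  · rw [push_basisVec_mk hLM x hx hx', weilT, Finsupp.linearCombination_single, one_smul,
      eQuad_mk hB hL', eQuad_mk hB hL]
  · rw [push_basisVec_of_notMem (hLM.trans hL.le_dual) x hx hx', map_zero, smul_zero]

theorem push_comp_weilS [FiniteDimensional ℚ V] (hB : B.IsSymm) (hnd : B.Nondegenerate)
    (hL : IsEvenLattice B L) (hL' : IsEvenLattice B L') (hLM : L' ≤ L) :
    push B L' L ∘ₗ weilS B L' = weilS B L ∘ₗ push B L' L := by
  classical
  have := finite_discGroup hnd hL'.isLattice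
  have := Fintype.ofFinite (DiscGroup B L')
  have := finite_discGroup hnd hL.isLattice
  have := Fintype.ofFinite (DiscGroup B L)
  have hLD : L ≤ B.dualSubmodule L' := hL.le_dual.trans (dual_anti hLM)
  refine Finsupp.lhom_ext' fun l => LinearMap.ext_ring (Finsupp.ext fun n => ?_)
  obtain ⟨⟨x, hx⟩, rfl⟩ := Submodule.mkQ_surjective _ l
  obtain ⟨y, rfl⟩ := Submodule.mkQ_surjective _ n
  change push B L' L (weilS B L' (basisVec B L' _)) _ =
    weilS B L (push B L' L (basisVec B L' _)) _
  set y' : B.dualSubmodule L' := ⟨y, dual_anti hLM y.2⟩ with hy'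
  have hsum : ∑ m : DiscGroup B L', ePairNeg B L' (discMk B L' ⟨x, hx⟩) m *
      push B L' L (basisVec B L' m) (discMk B L y) =
      e (-(B x y)) *
        if x ∈ B.dualSubmodule L then (Nat.card (overSub B L' L) : ℂ) else 0 := by
    -- Translating by y turns the sum over the coset y + J into a character sum over J, with e(-(x,
    -- y)) factored out.
    rw [← Equiv.sum_comp (Equiv.addLeft (discMk B L' y'))]
    simp only [Equiv.coe_addLeft, hy', push_basisVec_apply hLM hL.le_dual]
    rw [← sum_overSub hB hLM hLD ⟨x, hx⟩, Finset.mul_sum]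
    refine Finset.sum_congr rfl fun j _ => ?_
    rw [← pairChar_apply hB, AddChar.map_add_eq_mul, pairChar_apply, pairChar_apply,
      ePairNeg_mk hB]
    split_ifs <;> simp
  rw [weilS, Finsupp.linearCombination_single, one_smul, map_smul, finsum_eq_sum_of_fintype,
    map_sum]
  simp only [map_smul, Finsupp.smul_apply, Finsupp.finsetSum_apply, smul_eq_mul]
  rw [hsum]
  by_cases hx' : x ∈ B.dualSubmodule L
  · rw [push_basisVec_mk hLM x hx hx', weilS, Finsupp.linearCombination_single, one_smul,
      finsum_eq_sum_of_fintype, if_pos hx']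
    simp only [Finsupp.smul_apply, Finsupp.finsetSum_apply, smul_eq_mul, Finsupp.single_apply,
      mul_ite, mul_one, mul_zero]
    rw [Finset.sum_ite_eq', if_pos (Finset.mem_univ _), ePairNeg_mk hB,
      card_discGroup_eq_sq_mul hB hnd hL hL' hLM]
    have hJ : (Nat.card (overSub B L' L) : ℂ) ≠ 0 := by
      exact_mod_cast Nat.card_pos.ne'
    have hA : (Real.sqrt (Nat.card (DiscGroup B L)) : ℂ) ≠ 0 := by
      exact_mod_cast (Real.sqrt_pos.2 (by exact_mod_cast Nat.card_pos)).ne'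
    -- Now √|A_{L'}| = |J| √|A_L|, and this |J| cancels the one from the character sum.
    rw [Nat.cast_mul, Nat.cast_pow, Real.sqrt_mul (by positivity), Real.sqrt_sq (by positivity)]
    push_cast
    field_simp
  · rw [push_basisVec_of_notMem (hLM.trans hL.le_dual) x hx hx', map_zero, if_neg hx']
    simp

/-- The intertwining relation is stable under products, so it passes from the generators T and S to
the whole graph, the metaplectic component being kept fixed. Existence of some matching R' suffices
for modularity. -/
theorem exists_push_comp_eq [FiniteDimensional ℚ V] (hB : B.IsSymm) (hnd : B.Nondegenerate)
    (hL : IsEvenLattice B L) (hL' : IsEvenLattice B L') (hLM : L' ≤ L)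
    {a : Mp2Z × Module.End ℂ (CA B L)} (ha : a ∈ weilGraph B L) :
    ∃ R' : Module.End ℂ (CA B L'), (a.1, R') ∈ weilGraph B L' ∧
      push B L' L ∘ₗ R' = a.2 ∘ₗ push B L' L := by
  induction ha using Submonoid.closure_induction with
  | mem a ha =>
    rcases ha with rfl | rfl
    · exact ⟨weilT B L', Submonoid.subset_closure (Or.inl rfl), push_comp_weilT hB hL hL' hLM⟩
    · exact ⟨weilS B L', Submonoid.subset_closure (Or.inr rfl),
        push_comp_weilS hB hnd hL hL' hLM⟩
  | one => exact ⟨1, Submonoid.one_mem _, rfl⟩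
  | mul a b _ _ ha hb =>
    obtain ⟨R, hR, h⟩ := ha
    obtain ⟨S, hS, h'⟩ := hb
    refine ⟨R * S, Submonoid.mul_mem _ hR hS, ?_⟩
    change push B L' L ∘ₗ (R ∘ₗ S) = (a.2 ∘ₗ b.2) ∘ₗ push B L' L
    rw [← LinearMap.comp_assoc, h, LinearMap.comp_assoc, h', LinearMap.comp_assoc]

/-- Components of the pushforward are finite combinations with constant coefficients, so holomorphy
and growth bounds carry over. -/
theorem push_apply_eq_sum [Fintype (DiscGroup B L')] (v : CA B L') (n : DiscGroup B L) :
    push B L' L v n = ∑ l, push B L' L (basisVec B L' l) n * v l := by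
  classical
  conv_lhs => rw [← Finsupp.univ_sum_single v]
  rw [map_sum, Finsupp.finsetSum_apply]
  refine Finset.sum_congr rfl fun l _ => ?_
  have : Finsupp.single l (v l) = v l • basisVec B L' l := by simp
  rw [this, map_smul, Finsupp.smul_apply, smul_eq_mul, mul_comm]

theorem isBigO_exp_mono {a b : ℕ} (hab : a ≤ b) :
    (fun τ : ℍ => Real.exp (2 * Real.pi * a * τ.im)) =O[atImInfty]
      fun τ : ℍ => Real.exp (2 * Real.pi * b * τ.im) := by
  refine Asymptotics.IsBigO.of_norm_le fun τ => ?_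
  rw [Real.norm_eq_abs, abs_of_pos (Real.exp_pos _)]
  refine Real.exp_le_exp.2 ?_
  have : (a : ℝ) ≤ b := by exact_mod_cast hab
  have := τ.im_pos
  gcongr

theorem IsWeaklyHolomorphic.push [FiniteDimensional ℚ V] (hB : B.IsSymm) (hnd : B.Nondegenerate)
    (hL : IsEvenLattice B L) (hL' : IsEvenLattice B L') (hLM : L' ≤ L) {f : ℍ → CA B L'}
    (hf : IsWeaklyHolomorphic B L' f) :
    IsWeaklyHolomorphic B L fun τ => ThetaProduct.push B L' L (f τ) := by
  classical
  have := finite_discGroup hnd hL'.isLattice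
  have := Fintype.ofFinite (DiscGroup B L')
  refine ⟨fun n => ?_, fun g R hR τ => ?_, fun n => ?_⟩
  · simp only [push_apply_eq_sum (f _)]
    induction (Finset.univ : Finset (DiscGroup B L')) using Finset.induction_on with
    | empty => simpa using mdifferentiable_const
    | insert l s hl ih =>
      simp only [Finset.sum_insert hl]
      exact ((hf.holo l).const_smul _).add ih
  -- The weight depends only on `B`, so the automorphy factor is the same for both lattices.
  · obtain ⟨R', hR', h⟩ := exists_push_comp_eq hB hnd hL hL' hLM hR
    rw [hf.modular g R' hR' τ, map_smul]
    congr 1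
    exact LinearMap.congr_fun h (f τ)
  · choose N hN using hf.cusp
    refine ⟨Finset.univ.sup N, ?_⟩
    simp only [push_apply_eq_sum (f _)]
    refine Asymptotics.IsBigO.fun_sum fun l _ => ?_
    exact ((hN l).trans (isBigO_exp_mono (Finset.le_sup (Finset.mem_univ l)))).const_mul_left _

/-- The pushforward `M^!(L') → M^!(L)`. -/
def pushMShriek [FiniteDimensional ℚ V] (hB : B.IsSymm) (hnd : B.Nondegenerate)
    (hL : IsEvenLattice B L) (hL' : IsEvenLattice B L') (hLM : L' ≤ L) :
    MShriek B L' →ₗ[ℂ] MShriek B L where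
  toFun f := ⟨fun τ => push B L' L (f.1 τ), f.2.push hB hnd hL hL' hLM⟩
  map_add' f g := Subtype.ext (funext fun τ => map_add (push B L' L) (f.1 τ) (g.1 τ))
  map_smul' c f := Subtype.ext (funext fun τ => map_smul (push B L' L) c (f.1 τ))

end Pushforward

/-! ### Invariance of L^*, K and the theta contraction -/

section Theta

variable {V : Type*} [AddCommGroup V] [Module ℚ V] {B : LinearMap.BilinForm ℚ V}
  {L L' I : Submodule ℤ V}

/-- Vectors of `I_ℚ` are orthogonal to `I`, so pairing integrally with `L'` is the same as pairing
integrally with L' + I. -/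
theorem Istar_inf_eq (hspan : Submodule.span ℚ ((I ⊓ L' : Submodule ℤ V) : Set V) =
      Submodule.span ℚ (I : Set V)) (hB : B.IsSymm)
    (hI : ∀ x ∈ I, ∀ y ∈ I, B x y = 0) (hgen : L = L' ⊔ I) :
    Istar B L' (I ⊓ L') = Istar B L I := by
  unfold Istar
  rw [hspan]
  ext x
  refine ⟨fun hx => ⟨hx.1, ?_⟩, fun hx => ⟨hx.1, ?_⟩⟩
  · refine mem_dual_iff.2 fun y hy => ?_
    rw [hgen] at hy
    obtain ⟨a, ha, i, hi, rfl⟩ := Submodule.mem_sup.1 hy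
    obtain ⟨n, hn⟩ := mem_dual_iff.1 hx.2 a ha
    have h0 : B i x = 0 := span_isotropic hI hx.1 i (Submodule.subset_span hi)
    refine ⟨n, ?_⟩
    rw [map_add, hn, show B x i = 0 from (hB.eq x i).trans h0, add_zero]
  · exact dual_anti (hgen ▸ le_sup_left) hx.2

theorem Lstar_inf_eq (hspan : Submodule.span ℚ ((I ⊓ L' : Submodule ℤ V) : Set V) =
      Submodule.span ℚ (I : Set V)) (hB : B.IsSymm)
    (hI : ∀ x ∈ I, ∀ y ∈ I, B x y = 0) (hIL : I ≤ B.dualSubmodule L) (hgen : L = L' ⊔ I) :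
    Lstar B L' (I ⊓ L') = Lstar B L I := by
  have h : I ≤ Istar B L I := fun x hx => ⟨Submodule.subset_span hx, hIL hx⟩
  unfold Lstar
  rw [Istar_inf_eq hspan hB hI hgen]
  calc L' ⊔ Istar B L I = L' ⊔ (I ⊔ Istar B L I) := by rw [sup_eq_right.2 h]
    _ = L ⊔ Istar B L I := by rw [← sup_assoc, ← hgen]

/-- The spaces U^⊥/U and U'^⊥/U' are different types even when U' = U, so the lattices and classes
are compared through representatives in `V`; substituting the equality then makes both sides
identical. -/
theorem thetaSeries_congr (hB : B.IsSymm) {U U' : Submodule ℚ V} (hU : U' = U)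
    {K : Submodule ℤ (B.orthogonal U ⧸ U.submoduleOf (B.orthogonal U))}
    {K' : Submodule ℤ (B.orthogonal U' ⧸ U'.submoduleOf (B.orthogonal U'))}
    (hK : ∀ (x : V) (hx : x ∈ B.orthogonal U) (hx' : x ∈ B.orthogonal U'),
      Submodule.Quotient.mk ⟨x, hx'⟩ ∈ K' ↔ Submodule.Quotient.mk ⟨x, hx⟩ ∈ K)
    (x : V) (hx : x ∈ B.orthogonal U) (hx' : x ∈ B.orthogonal U')
    (hd : Submodule.Quotient.mk ⟨x, hx⟩ ∈ (quotForm hB U).dualSubmodule K)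
    (hd' : Submodule.Quotient.mk ⟨x, hx'⟩ ∈ (quotForm hB U').dualSubmodule K') (τ : ℍ) :
    thetaSeries (quotForm hB U') K' τ (discMk _ _ ⟨_, hd'⟩) =
      thetaSeries (quotForm hB U) K τ (discMk _ _ ⟨_, hd⟩) := by
  subst hU
  have : K' = K := by
    ext z
    obtain ⟨⟨z, hz⟩, rfl⟩ := Submodule.Quotient.mk_surjective _ z
    exact hK z hz hz
  subst this
  rfl

theorem quotMk_mem_latticeK_iff (x : B.orthogonal (Submodule.span ℚ (I : Set V))) :
    quotMk B I x ∈ latticeK B L I ↔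
      ∃ y ∈ L, y ∈ B.orthogonal (Submodule.span ℚ (I : Set V)) ∧
        y - x ∈ Submodule.span ℚ (I : Set V) := by
  constructor
  · rintro ⟨y, hy, h⟩
    exact ⟨y, hy, y.2, (Submodule.Quotient.eq (p := (Submodule.span ℚ (I : Set V)).submoduleOf _)).1 h⟩
  · rintro ⟨y, hy, hy', h⟩
    exact ⟨⟨y, hy'⟩, hy, (Submodule.Quotient.eq _).2 h⟩

/-- A vector a + i of I^⊥ ∩ L with a ∈ L' and i ∈ I may be replaced by a: isotropy keeps a in I^⊥,
and the class modulo `I_ℚ` does not change. -/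
theorem quotMk_mem_latticeK_inf_iff (hspan : Submodule.span ℚ ((I ⊓ L' : Submodule ℤ V) : Set V) =
      Submodule.span ℚ (I : Set V)) (hI : ∀ x ∈ I, ∀ y ∈ I, B x y = 0) (hgen : L = L' ⊔ I)
    (x : V) (hx : x ∈ B.orthogonal (Submodule.span ℚ (I : Set V)))
    (hx' : x ∈ B.orthogonal (Submodule.span ℚ ((I ⊓ L' : Submodule ℤ V) : Set V))) :
    quotMk B (I ⊓ L') ⟨x, hx'⟩ ∈ latticeK B L' (I ⊓ L') ↔
      quotMk B I ⟨x, hx⟩ ∈ latticeK B L I := by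
  rw [quotMk_mem_latticeK_iff, quotMk_mem_latticeK_iff]
  simp only [hspan]
  constructor
  · rintro ⟨y, hy, h⟩
    exact ⟨y, hgen ▸ Submodule.mem_sup_left hy, h⟩
  · rintro ⟨y, hy, hyO, h⟩
    rw [hgen] at hy
    obtain ⟨a, ha, i, hi, rfl⟩ := Submodule.mem_sup.1 hy
    have hiU : i ∈ Submodule.span ℚ (I : Set V) := Submodule.subset_span hi
    refine ⟨a, ha, ?_, ?_⟩
    · simpa using Submodule.sub_mem _ hyO (span_isotropic hI hiU)
    · have := Submodule.sub_mem _ h hiU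
      rwa [show a + i - x - i = a - x by abel] at this

/-- The orthogonal representative z is a parameter, so that one choice can serve for both `L` and
`L'`. -/
theorem linearCombination_thetaSeries_pushK_of_mem (hB : B.IsSymm)
    (hI : ∀ x ∈ I, ∀ y ∈ I, B x y = 0) (x z : V) (hx : x ∈ B.dualSubmodule L)
    (hx' : x ∈ B.dualSubmodule (Lstar B L I)) (hz : z ∈ B.dualSubmodule (Lstar B L I))
    (hzO : z ∈ B.orthogonal (Submodule.span ℚ (I : Set V))) (hxz : z - x ∈ Lstar B L I) (τ : ℍ) :
    Finsupp.linearCombination ℂ (thetaSeries (quotB hB I) (latticeK B L I) τ)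
      (pushK hB L I (basisVec B L (discMk B L ⟨x, hx⟩))) =
      thetaSeries (quotB hB I) (latticeK B L I) τ
        (discMk _ _ ⟨quotMk B I ⟨z, hzO⟩, quotMk_mem_dual hB L I ⟨z, hzO⟩ hz⟩) := by
  have h : discMk B (Lstar B L I) ⟨x, hx'⟩ = discMk B (Lstar B L I) ⟨z, hz⟩ :=
    (discMk_eq_iff.2 hxz).symm
  rw [pushK, LinearMap.comp_apply, push_basisVec_mk le_sup_left x hx hx', h,
    Finsupp.lmapDomain_apply, Finsupp.mapDomain_single, Finsupp.linearCombination_single, one_smul,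
    discIso_mk hB hI ⟨z, hzO⟩ hz]

theorem pushK_of_notMem (hB : B.IsSymm) (h : L ≤ B.dualSubmodule (Lstar B L I)) (x : V)
    (hx : x ∈ B.dualSubmodule L) (hx' : x ∉ B.dualSubmodule (Lstar B L I)) :
    pushK hB L I (basisVec B L (discMk B L ⟨x, hx⟩)) = 0 := by
  rw [pushK, LinearMap.comp_apply, push_basisVec_of_notMem h x hx hx', map_zero]

theorem IsEvenLattice.le_dual_Lstar (hB : B.IsSymm) (hL : IsEvenLattice B L) (I : Submodule ℤ V) :
    L ≤ B.dualSubmodule (Lstar B L I) := by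
  refine fun y hy => mem_dual_iff.2 fun w hw => ?_
  obtain ⟨a, ha, i, hi, rfl⟩ := Submodule.mem_sup.1 hw
  obtain ⟨m, hm⟩ := hL.integral y hy a ha
  obtain ⟨n, hn⟩ := mem_dual_iff.1 hi.2 y hy
  refine ⟨m + n, ?_⟩
  rw [map_add, hm, show B y i = n from (hB.eq y i).trans hn]
  push_cast
  rfl

/-- Both sides are linear functionals of f(τ), so they are compared on basis vectors e_x. If x ∈
(L^*)^∨, both give the theta coefficient of the same class in K^∨/K; otherwise both vanish. -/
theorem xi_push (hB : B.IsSymm) (hnd : B.Nondegenerate) (hL : IsEvenLattice B L)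
    (hL' : IsEvenLattice B L') (hspan : Submodule.span ℚ ((I ⊓ L' : Submodule ℤ V) : Set V) =
      Submodule.span ℚ (I : Set V)) (hI : ∀ x ∈ I, ∀ y ∈ I, B x y = 0) (hgen : L = L' ⊔ I)
    (f : ℍ → CA B L') (τ : ℍ) :
    xi hB L I (fun τ => push B L' L (f τ)) τ = xi hB L' (I ⊓ L') f τ := by
  have hIL : I ≤ L := hgen ▸ le_sup_right
  have hLM : L' ≤ L := hgen ▸ le_sup_left
  have hstar : Lstar B L' (I ⊓ L') = Lstar B L I :=
    Lstar_inf_eq hspan hB hI (hIL.trans hL.le_dual) hgen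
  suffices h : (Finsupp.linearCombination ℂ (thetaSeries (quotB hB I) (latticeK B L I) τ) ∘ₗ
      pushK hB L I) ∘ₗ push B L' L =
      Finsupp.linearCombination ℂ (thetaSeries (quotB hB (I ⊓ L')) (latticeK B L' (I ⊓ L')) τ) ∘ₗ
        pushK hB L' (I ⊓ L') from LinearMap.congr_fun h (f τ)
  refine Finsupp.lhom_ext' fun l => LinearMap.ext_ring ?_
  obtain ⟨⟨x, hx⟩, rfl⟩ := Submodule.mkQ_surjective _ l
  change Finsupp.linearCombination ℂ _ (pushK hB L I (push B L' L (basisVec B L' _))) =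
    Finsupp.linearCombination ℂ _ (pushK hB L' (I ⊓ L') (basisVec B L' _))
  have hsub : B.dualSubmodule (Lstar B L I) ≤ B.dualSubmodule L := dual_anti le_sup_left
  by_cases hxs : x ∈ B.dualSubmodule (Lstar B L I)
  · obtain ⟨⟨z, hzO⟩, hz, h⟩ :=
      exists_orthogonal_rep hB hnd hL hIL (discMk B (Lstar B L I) ⟨x, hxs⟩)
    rw [discMk_eq_iff] at h
    have hzO' : z ∈ B.orthogonal (Submodule.span ℚ ((I ⊓ L' : Submodule ℤ V) : Set V)) := by
      rw [hspan]; exact hzO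
    have hz' : z ∈ B.dualSubmodule (Lstar B L' (I ⊓ L')) := by rw [hstar]; exact hz
    rw [push_basisVec_mk hLM x hx (hsub hxs),
      linearCombination_thetaSeries_pushK_of_mem hB hI x z (hsub hxs) hxs hz hzO h,
      linearCombination_thetaSeries_pushK_of_mem hB (I := I ⊓ L') (fun a ha b hb => hI a ha.1 b hb.1) x z hx
        (by rw [hstar]; exact hxs) hz' hzO' (by rw [hstar]; exact h)]
    exact (thetaSeries_congr hB hspan
      (fun w hw hw' => quotMk_mem_latticeK_inf_iff hspan hI hgen w hw hw') z hzO hzO' _ _ τ).symm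
  · rw [pushK_of_notMem hB (hL'.le_dual_Lstar hB _) x hx (by rwa [hstar]), map_zero]
    -- Outside (L^*)^∨ the two-stage pushforward vanishes either at its second stage, when x ∈ L^∨,
    -- or already at its first.
    by_cases hxL : x ∈ B.dualSubmodule L
    · rw [push_basisVec_mk hLM x hx hxL, pushK_of_notMem hB (hL.le_dual_Lstar hB _) x hxL hxs,
        map_zero]
    · rw [push_basisVec_of_notMem (hLM.trans hL.le_dual) x hx hxL, map_zero, map_zero]

end Theta

end

end ThetaProduct


/-! ### Compatibility of the pushforward with the Θ-products -/

theorem mainTheorem7 {V : Type*} [AddCommGroup V] [Module ℚ V] [FiniteDimensional ℚ V]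
    (B : LinearMap.BilinForm ℚ V) (hB : B.IsSymm) (hnd : B.Nondegenerate)
    (p q : ℕ) (hp : sigPos B.toQuadraticMap = p)
    (hq : sigNeg B.toQuadraticMap = q) (hpq : p ≤ q)
    (L L' I : Submodule ℤ V) (hL : ThetaProduct.IsEvenLattice B L)
    (hI : ThetaProduct.IsMaximalIsotropic B L I p)
    (hL' : L' ≤ L) (hfin : Finite (L ⧸ L'.submoduleOf L)) (hgen : L = L' ⊔ I) :
    ∃ Φ : ThetaProduct.MShriek B L' →ₗ[ℂ] ThetaProduct.MShriek B L,
      (∀ (f : ThetaProduct.MShriek B L') (τ : UpperHalfPlane),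
        (Φ f).1 τ = ThetaProduct.push B L' L (f.1 τ)) ∧
      ∀ (f g : ThetaProduct.MShriek B L') (τ : UpperHalfPlane),
        ThetaProduct.thetaProd hB L I (Φ f).1 (Φ g).1 τ =
          ThetaProduct.push B L' L (ThetaProduct.thetaProd hB L' (I ⊓ L') f.1 g.1 τ) := by
  have hL'' := hL.of_finite_quotient hL' hfin
  refine ⟨ThetaProduct.pushMShriek hB hnd hL hL'' hL', fun f τ => rfl, fun f g τ => ?_⟩
  have hxi := ThetaProduct.xi_push hB hnd hL hL''
    (ThetaProduct.span_inf_of_finite_quotient hfin hI.le) hI.isotropic hgen f.1 τ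
  change ThetaProduct.xi hB L I (fun τ => ThetaProduct.push B L' L (f.1 τ)) τ •
    ThetaProduct.push B L' L (g.1 τ) =
      ThetaProduct.push B L' L (ThetaProduct.xi hB L' (I ⊓ L') f.1 τ • g.1 τ)
  rw [hxi, map_smul]
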